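/- For a non-negative integer $N$, $\mu\in\mathbb Z$ and $t\in\mathbb C$ let $$\tau^{III'}[N](t;\mu)=\Big\langle \prod_{l=1}^N z_l^{\mu}\,e^{\frac12\sqrt t\,(z_l+z_l^{-1})}\Big\rangle_{U(N)},\qquad z_l=e^{i\theta_l},$$ where $\langle\cdot\rangle_{U(N)}$ is the average with respect to the probability density $\frac{1}{(2\pi)^N N!}\prod_{1\le j<k\le N}|z_k-z_j|^2$ on $-\pi\le\theta_1,\dots,\theta_N\le\pi$ (so $\tau^{III'}[0]=1$), and $\sqrt{\cdot}$ is the principal square root. Let $I_n(x)=\sum_{k\ge0}\frac{(x/2)^{2k+n}}{k!\,(k+n)!}$ be the modified Bessel function. For $t\in\mathbb C\setminus\{0\}$ consider the sequence $P_0,P_1,P_2,\dots$ given by the discrete Painlevé II equation $$P_{n+1}+P_{n-1}=\frac{nP_n}{\sqrt t\,(1-P_n^2)},\qquad n=1,2,\dots,\qquad P_0=1,\quad P_1=\frac{I_1(2\sqrt t)}{I_0(2\sqrt t)}.$$ 1. If $t>0$, then this sequence is well defined: there is exactly one sequence $(P_n)_{n\ge0}$ with these initial values satisfying the equation for all $n\ge1$,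 where $I_0(2\sqrt t)\ne0$ and $1-P_n^2\neq0$ for all $n\ge1$. 2. Let $t\in\mathbb C\setminus\{0\}$ and let $M\ge1$ be such that $P_0,\dots,P_M$ are defined, i.e. $I_0(2\sqrt t)\neq0$, $1-P_n^2\ne0$ for $1\le n<M$, and the equation holds for $1\le n<M$. Then for every $1\le N\le M$ one has $\tau^{III'}[N](4t;0)\ne0$ and $$\frac{\tau^{III'}[N+1](4t;0)\,\tau^{III'}[N-1](4t;0)}{\tau^{III'}[N](4t;0)^2}=1-P_N^2 .$$ In particular, for $t>0$ the last identity holds for all $N\ge1$. -/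

import Mathlib

/-- The modified Bessel function of the first kind `I_n(x)` of order `n = 0, 1, 2, …`,
`I_n(x) = ∑_{k ≥ 0} (x/2)^(2k+n) / (k! (k+n)!)`. -/
noncomputable def besselI (n : ℕ) (x : ℂ) : ℂ :=
  ∑' k : ℕ, (x / 2) ^ (2 * k + n) / ((k.factorial : ℂ) * ((k + n).factorial : ℂ))

/-- The point `z = e^{iθ}` of the unit circle. -/
noncomputable def circlePoint (θ : ℝ) : ℂ :=
  Complex.exp (Complex.I * (θ : ℂ))

/-- The eigenvalue probability density of `U(N)` in the eigenangles,
`(1 / ((2π)^N N!)) ∏_{j<k} |z_k - z_j|^2` with `z_l = e^{iθ_l}`. -/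
noncomputable def unitaryDensity (N : ℕ) (θ : Fin N → ℝ) : ℝ :=
  1 / ((2 * Real.pi) ^ N * (N.factorial : ℝ)) *
    ∏ j : Fin N, ∏ k ∈ Finset.Ioi j, ‖circlePoint (θ k) - circlePoint (θ j)‖ ^ 2

/-- The average `⟨∏_{l=1}^N w(z_l)⟩_{U(N)}`, over `-π ≤ θ_l ≤ π`. -/
noncomputable def unitaryAverage (N : ℕ) (w : ℂ → ℂ) : ℂ :=
  ∫ θ in Set.univ.pi (fun _ : Fin N => Set.Icc (-Real.pi) Real.pi),
    (∏ l : Fin N, w (circlePoint (θ l))) * (unitaryDensity N θ : ℂ)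

/-- The `τ`-function `τ^{III'}[N](t; μ) = ⟨∏_l z_l^μ e^{(1/2) √t (z_l + 1/z_l)}⟩_{U(N)}`
for integer `μ` and complex `t`; `t ^ (1/2)` is the principal square root. -/
noncomputable def tauIII (N : ℕ) (t : ℂ) (μ : ℤ) : ℂ :=
  unitaryAverage N fun z =>
    z ^ μ * Complex.exp (1 / 2 * t ^ (1 / 2 : ℂ) * (z + z⁻¹))

/-- `P_0, …, P_M` are obtained, without any division by zero, from the initial values
`P_0 = 1`, `P_1 = I_1(2√t) / I_0(2√t)` and the discrete Painlevé II equation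
`P_{n+1} + P_{n-1} = n P_n / (√t (1 - P_n^2))` for `1 ≤ n < M`. -/
structure IsDiscretePII (t : ℂ) (M : ℕ) (P : ℕ → ℂ) : Prop where
  init_zero : P 0 = 1
  denom_init : besselI 0 (2 * t ^ (1 / 2 : ℂ)) ≠ 0
  init_one : P 1 = besselI 1 (2 * t ^ (1 / 2 : ℂ)) / besselI 0 (2 * t ^ (1 / 2 : ℂ))
  denom_step : ∀ n : ℕ, 1 ≤ n → n < M → 1 - P n ^ 2 ≠ 0
  step : ∀ n : ℕ, 1 ≤ n → n < M →
    P (n + 1) + P (n - 1) = (n : ℂ) * P n / (t ^ (1 / 2 : ℂ) * (1 - P n ^ 2))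

/-! The proof runs from the Painlevé sequence to the orthogonal polynomials. Put s = √t and let
B(p,q) be the mean of p(z) q(1/z) e^{s(z+1/z)} over the unit circle. Feed a_n = (-1)^n P_n into the
Szegő recurrence and write h_n = B(Φ_n, z^n). By induction the Φ_n are orthogonal for B. The passage
from n to n+1 needs only B(zΦ_n, 1) + a_{n+1} h_n = 0. For n = 0 this is the Bessel initial value;
for n ≥ 1 it follows from integration by parts against the weight combined with discrete Painlevé II
(`IsDiscretePII.szego_step`). The same passage gives h_{n+1} = h_n (1 - P_{n+1}²)
(`SzegoOrthogonal.succ`). Expanding the Vandermonde determinants in monic orthogonal polynomials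
gives τ[N](4t;0) = h_0 ⋯ h_{N-1} (`IsDiscretePII.tauIII_eq`), so the ratio of τ-functions is h_N /
h_{N-1} = 1 - P_N². For t > 0 the weight is positive, hence h_n ≠ 0, which forces 1 - P_n² ≠ 0. -/

section SzegoRecurrence

/-! ### Szegő recurrence and orthogonality for an abstract symmetric shift-invariant pairing. -/

open Polynomial

variable {R : Type*} [CommRing R]

/-- The pair `(Φ_n, Φ_n^*)` produced by the Szegő recurrence with real-type coefficients `a`:
`Φ_{n+1} = X Φ_n + a_{n+1} Φ_n^*` and `Φ_{n+1}^* = Φ_n^* + a_{n+1} X Φ_n`. -/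
noncomputable def szegoPair (a : ℕ → R) : ℕ → R[X] × R[X]
  | 0 => (1, 1)
  | n + 1 => (X * (szegoPair a n).1 + C (a (n + 1)) * (szegoPair a n).2,
      (szegoPair a n).2 + C (a (n + 1)) * (X * (szegoPair a n).1))

/-- The `n`-th polynomial of the Szegő recurrence. -/
noncomputable def szegoPoly (a : ℕ → R) (n : ℕ) : R[X] := (szegoPair a n).1

/-- The reversed `n`-th polynomial of the Szegő recurrence. -/
noncomputable def szegoRev (a : ℕ → R) (n : ℕ) : R[X] := (szegoPair a n).2

variable (a : ℕ → R)

@[simp] lemma szegoPoly_zero : szegoPoly a 0 = 1 := rfl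

@[simp] lemma szegoRev_zero : szegoRev a 0 = 1 := rfl

lemma szegoPoly_succ (n : ℕ) :
    szegoPoly a (n + 1) = X * szegoPoly a n + C (a (n + 1)) * szegoRev a n := rfl

lemma szegoRev_succ (n : ℕ) :
    szegoRev a (n + 1) = szegoRev a n + C (a (n + 1)) * (X * szegoPoly a n) := rfl

lemma szego_coeff_of_lt (n : ℕ) :
    (∀ m, n < m → (szegoPoly a n).coeff m = 0) ∧ ∀ m, n < m → (szegoRev a n).coeff m = 0 := by
  induction n with
  | zero => constructor <;> intro m hm <;> simp [coeff_one, hm.ne']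
  | succ n ih =>
    constructor <;> intro m hm <;> obtain ⟨m, rfl⟩ : ∃ k, m = k + 1 := ⟨m - 1, by omega⟩
    · simp [szegoPoly_succ, ih.1 m (by omega), ih.2 (m + 1) (by omega)]
    · simp [szegoRev_succ, ih.1 m (by omega), ih.2 (m + 1) (by omega)]

lemma szegoPoly_coeff_self (n : ℕ) : (szegoPoly a n).coeff n = 1 := by
  induction n with
  | zero => simp
  | succ n ih => simp [szegoPoly_succ, ih, (szego_coeff_of_lt a n).2 (n + 1) (by omega)]

lemma szegoRev_coeff_zero (n : ℕ) : (szegoRev a n).coeff 0 = 1 := by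
  induction n with
  | zero => simp
  | succ n ih => simp [szegoRev_succ, ih]

lemma szegoPoly_coeff_zero (ha : a 0 = 1) (n : ℕ) : (szegoPoly a n).coeff 0 = a n := by
  cases n with
  | zero => simp [ha]
  | succ n => simp [szegoPoly_succ, szegoRev_coeff_zero]

lemma szegoRev_coeff_self (ha : a 0 = 1) (n : ℕ) : (szegoRev a n).coeff n = a n := by
  cases n with
  | zero => simp [ha]
  | succ n =>
    simp [szegoRev_succ, szegoPoly_coeff_self, (szego_coeff_of_lt a n).2 (n + 1) (by omega)]

lemma szegoPoly_natDegree [Nontrivial R] (n : ℕ) : (szegoPoly a n).natDegree = n :=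
  natDegree_eq_of_le_of_coeff_ne_zero
    (natDegree_le_iff_coeff_eq_zero.2 (szego_coeff_of_lt a n).1)
    (by simp [szegoPoly_coeff_self])

lemma szegoPoly_monic (n : ℕ) : (szegoPoly a n).Monic :=
  monic_of_natDegree_le_of_coeff_eq_one n
    (natDegree_le_iff_coeff_eq_zero.2 (szego_coeff_of_lt a n).1) (szegoPoly_coeff_self a n)

variable {a} {B : R[X] →ₗ[R] R[X] →ₗ[R] R}

lemma pairing_eq_sum (p : R[X]) {q : R[X]} {n : ℕ} (hq : ∀ m, n ≤ m → q.coeff m = 0) :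
    B p q = ∑ k ∈ Finset.range n, q.coeff k * B p (X ^ k) := by
  have h : q = ∑ k ∈ Finset.range n, q.coeff k • X ^ k := by
    ext m
    simp only [finsetSum_coeff, coeff_smul, coeff_X_pow, smul_eq_mul, mul_ite, mul_one, mul_zero,
      Finset.sum_ite_eq, Finset.mem_range]
    split_ifs with hm
    · rfl
    · exact hq m (not_lt.1 hm)
  conv_lhs => rw [h]
  simp [map_sum]

/-- Orthogonality of the `n`-th polynomials of the Szegő recurrence with respect to a pairing. -/
structure SzegoOrthogonal (B : R[X] →ₗ[R] R[X] →ₗ[R] R) (a : ℕ → R) (n : ℕ) : Prop where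
  poly : ∀ k < n, B (szegoPoly a n) (X ^ k) = 0
  rev : ∀ k, 1 ≤ k → k ≤ n → B (szegoRev a n) (X ^ k) = 0
  norm : B (szegoRev a n) 1 = B (szegoPoly a n) (X ^ n)

/-- This encodes Φ_n^*(z) = z^n Φ_n(1/z) at the level of the pairing, for arbitrary coefficients and
without orthogonality. The offset k is free because the induction step uses k + 1. -/
lemma szego_reversal (symm : ∀ p q, B p q = B q p) (shift : ∀ p q, B (X * p) (X * q) = B p q)
    (n : ℕ) : (∀ k, B (szegoRev a n) (X ^ (n + k)) = B (X ^ k * szegoPoly a n) 1) ∧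
      ∀ k, B (X ^ k * szegoRev a n) 1 = B (szegoPoly a n) (X ^ (n + k)) := by
  induction n with
  | zero => simpa using ⟨fun k => symm 1 (X ^ k), fun k => symm (X ^ k) 1⟩
  | succ n ih =>
    have e1 : ∀ k, B (X * szegoPoly a n) (X ^ (n + 1 + k)) = B (szegoPoly a n) (X ^ (n + k)) := by
      intro k; rw [show (X : R[X]) ^ (n + 1 + k) = X * X ^ (n + k) by ring, shift]
    have e2 : ∀ k, B (szegoRev a n) (X ^ (n + 1 + k)) = B (X ^ (k + 1) * szegoPoly a n) 1 := by
      intro k; rw [← ih.1, show n + 1 + k = n + (k + 1) by ring]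
    have e3 : ∀ k, X ^ k * (X * szegoPoly a n) = X ^ (k + 1) * szegoPoly a n := by
      intro k; ring
    constructor <;> intro k <;>
      simp only [szegoRev_succ, szegoPoly_succ, map_add, LinearMap.add_apply, mul_add,
        ← smul_eq_C_mul, map_smul, LinearMap.smul_apply, mul_smul_comm, e1, e2, e3, ih.2]

lemma szegoOrthogonal_zero : SzegoOrthogonal B a 0 :=
  ⟨by simp, by intros; omega, by simp⟩

/-- Hypothesis `hb` says that `a (n + 1)` is the right Verblunsky coefficient, in a form free of
division by the norm. It makes Φ_{n+1} orthogonal to 1 and Φ_{n+1}^* orthogonal to z^{n+1}; the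
other relations are inherited by shift. -/
lemma SzegoOrthogonal.succ (symm : ∀ p q, B p q = B q p)
    (shift : ∀ p q, B (X * p) (X * q) = B p q) {n : ℕ} (h : SzegoOrthogonal B a n)
    (hb : B (X * szegoPoly a n) 1 + a (n + 1) * B (szegoPoly a n) (X ^ n) = 0) :
    SzegoOrthogonal B a (n + 1) ∧ B (szegoPoly a (n + 1)) (X ^ (n + 1)) =
      B (szegoPoly a n) (X ^ n) * (1 - a (n + 1) ^ 2) := by
  have e1 : ∀ k, B (X * szegoPoly a n) (X ^ (k + 1)) = B (szegoPoly a n) (X ^ k) := by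
    intro k; rw [show (X : R[X]) ^ (k + 1) = X * X ^ k by ring, shift]
  have e2 : B (szegoRev a n) (X ^ (n + 1)) = B (X * szegoPoly a n) 1 := by
    simpa using (szego_reversal (a := a) symm shift n).1 1
  have hn : B (szegoPoly a (n + 1)) (X ^ (n + 1)) =
      B (szegoPoly a n) (X ^ n) * (1 - a (n + 1) ^ 2) := by
    simp only [szegoPoly_succ, map_add, LinearMap.add_apply, ← smul_eq_C_mul, map_smul,
      LinearMap.smul_apply, e1, e2, smul_eq_mul]
    linear_combination a (n + 1) * hb
  refine ⟨⟨fun k hk => ?_, fun k hk hk' => ?_, ?_⟩, hn⟩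
  · simp only [szegoPoly_succ, map_add, LinearMap.add_apply, ← smul_eq_C_mul, map_smul,
      LinearMap.smul_apply, smul_eq_mul]
    cases k with
    | zero => simpa [h.norm] using hb
    | succ k => rw [e1, h.poly k (by omega), h.rev _ (by omega) (by omega)]; simp
  · simp only [szegoRev_succ, map_add, LinearMap.add_apply, ← smul_eq_C_mul, map_smul,
      LinearMap.smul_apply, smul_eq_mul]
    obtain ⟨k, rfl⟩ : ∃ j, k = j + 1 := ⟨k - 1, by omega⟩
    rw [e1]
    rcases Nat.lt_or_ge k n with hkn | hkn
    · rw [h.poly k hkn, h.rev _ (by omega) (by omega)]; simp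
    · obtain rfl : k = n := by omega
      rw [e2, hb]
  · rw [hn]
    simp only [szegoRev_succ, map_add, LinearMap.add_apply, ← smul_eq_C_mul, map_smul,
      LinearMap.smul_apply, smul_eq_mul, h.norm]
    linear_combination a (n + 1) * hb

/-- Pairing with a polynomial of degree at most `n` only sees its `n`-th coefficient. -/
lemma SzegoOrthogonal.poly_pairing {n : ℕ} (h : SzegoOrthogonal B a n) {q : R[X]}
    (hq : ∀ m, n < m → q.coeff m = 0) :
    B (szegoPoly a n) q = q.coeff n * B (szegoPoly a n) (X ^ n) := by
  rw [pairing_eq_sum (n := n + 1) _ hq, Finset.sum_range_succ, Finset.sum_eq_zero, zero_add]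
  intro k hk
  rw [h.poly k (Finset.mem_range.1 hk), mul_zero]

/-- Pairing with a polynomial of degree at most `n` only sees its constant coefficient. -/
lemma SzegoOrthogonal.rev_pairing {n : ℕ} (h : SzegoOrthogonal B a n) {q : R[X]}
    (hq : ∀ m, n < m → q.coeff m = 0) :
    B (szegoRev a n) q = q.coeff 0 * B (szegoPoly a n) (X ^ n) := by
  rw [pairing_eq_sum (n := n + 1) _ hq, Finset.sum_range_succ', Finset.sum_eq_zero, zero_add,
    pow_zero, h.norm]
  intro k hk
  rw [h.rev (k + 1) (by omega) (by simpa [Nat.succ_le_iff] using hk), mul_zero]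

/-- The relation between consecutive coefficients that the integration by parts formula
for the weight forces on orthogonal polynomials. -/
lemma SzegoOrthogonal.integration_by_parts (symm : ∀ p q, B p q = B q p)
    (shift : ∀ p q, B (X * p) (X * q) = B p q) {s : R}
    (ibp : ∀ p q, B (X * derivative p) q - B p (X * derivative q) +
      s * (B (X * p) q - B p (X * q)) = 0) (ha : a 0 = 1)
    {n : ℕ} (h : SzegoOrthogonal B a n) (h' : SzegoOrthogonal B a (n + 1)) :
    s * (B (X * szegoPoly a (n + 1)) 1 - a n * B (szegoPoly a (n + 1)) (X ^ (n + 1))) =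
      (n + 1) * a (n + 1) * B (szegoPoly a n) (X ^ n) := by
  -- For this test pair every pairing reduces, by orthogonality, to a single coefficient or to
  -- B(zΦ_{n+1}, 1).
  have key := ibp (szegoPoly a (n + 1)) (szegoRev a n)
  have e1 : B (szegoPoly a (n + 1)) (szegoRev a n) = 0 := by
    rw [h'.poly_pairing fun m hm => (szego_coeff_of_lt a n).2 m (by omega),
      (szego_coeff_of_lt a n).2 (n + 1) (by omega), zero_mul]
  have e2 : B (szegoPoly a (n + 1)) (X * derivative (szegoRev a n)) = 0 := by
    have hc : ∀ m, n < m → (X * derivative (szegoRev a n)).coeff m = 0 := by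
      intro m hm
      obtain ⟨m, rfl⟩ : ∃ k, m = k + 1 := ⟨m - 1, by omega⟩
      rw [coeff_X_mul, coeff_derivative, (szego_coeff_of_lt a n).2 _ hm, zero_mul]
    rw [h'.poly_pairing fun m hm => hc m (by omega), hc _ (by omega), zero_mul]
  have e3 : B (szegoPoly a (n + 1)) (X * szegoRev a n) =
      a n * B (szegoPoly a (n + 1)) (X ^ (n + 1)) := by
    rw [h'.poly_pairing, coeff_X_mul, szegoRev_coeff_self a ha]
    intro m hm
    obtain ⟨m, rfl⟩ : ∃ k, m = k + 1 := ⟨m - 1, by omega⟩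
    rw [coeff_X_mul, (szego_coeff_of_lt a n).2 m (by omega)]
  have e4 : B (X * szegoPoly a (n + 1)) (szegoRev a n) = B (X * szegoPoly a (n + 1)) 1 := by
    rw [pairing_eq_sum (n := n + 1) _ (fun m hm => (szego_coeff_of_lt a n).2 m hm),
      Finset.sum_range_succ', Finset.sum_eq_zero, szegoRev_coeff_zero]
    · simp
    · intro k hk
      rw [pow_succ', shift, h'.poly k (by have := Finset.mem_range.1 hk; omega), mul_zero]
  have e5 : B (X * derivative (szegoPoly a (n + 1))) (szegoRev a n) =
      -((n + 1) * a (n + 1) * B (szegoPoly a n) (X ^ n)) := by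
    -- Subtracting (n+1)Φ_{n+1} cancels the leading term, so the degree is at most n and Φ_n^* sees
    -- only the constant coefficient -(n+1)a_{n+1}.
    have hd : B (X * derivative (szegoPoly a (n + 1)) -
        (n + 1 : R) • szegoPoly a (n + 1)) (szegoRev a n) =
        -((n + 1) * a (n + 1) * B (szegoPoly a n) (X ^ n)) := by
      rw [symm, h.rev_pairing]
      · simp [szegoPoly_coeff_zero a ha]
      · intro m hm
        obtain ⟨m, rfl⟩ : ∃ k, m = k + 1 := ⟨m - 1, by omega⟩
        rw [coeff_sub, coeff_X_mul, coeff_derivative, coeff_smul, smul_eq_mul]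
        rcases (Nat.lt_succ_iff.1 hm).eq_or_lt with rfl | hlt
        · ring
        · rw [(szego_coeff_of_lt a (n + 1)).1 _ (by omega)]; ring
    simpa [e1] using hd
  rw [e2, e3, e4, e5] at key
  linear_combination key

end SzegoRecurrence


/-! ### The pairing on the unit circle: symmetry, integration by parts, positivity. -/

section CirclePairing

open Polynomial

lemma circlePoint_ne_zero (θ : ℝ) : circlePoint θ ≠ 0 := Complex.exp_ne_zero _

lemma circlePoint_neg (θ : ℝ) : circlePoint (-θ) = (circlePoint θ)⁻¹ := by
  simp [circlePoint, ← Complex.exp_neg]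

lemma conj_circlePoint (θ : ℝ) : (starRingEnd ℂ) (circlePoint θ) = (circlePoint θ)⁻¹ := by
  simp [circlePoint, ← Complex.exp_neg, ← Complex.exp_conj]

lemma norm_circlePoint (θ : ℝ) : ‖circlePoint θ‖ = 1 := by
  rw [circlePoint, mul_comm, Complex.norm_exp_ofReal_mul_I]

@[fun_prop] lemma continuous_circlePoint : Continuous circlePoint := by
  unfold circlePoint; fun_prop

@[fun_prop] lemma continuous_circlePoint_inv : Continuous fun θ => (circlePoint θ)⁻¹ :=
  continuous_circlePoint.inv₀ circlePoint_ne_zero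

lemma hasDerivAt_circlePoint (θ : ℝ) :
    HasDerivAt circlePoint (Complex.I * circlePoint θ) θ := by
  have h := ((Complex.ofRealCLM.hasDerivAt (x := θ)).const_mul Complex.I).cexp
  convert! h using 1
  simp [circlePoint, mul_comm]

lemma hasDerivAt_circlePoint_inv (θ : ℝ) :
    HasDerivAt (fun θ => (circlePoint θ)⁻¹) (-(Complex.I * (circlePoint θ)⁻¹)) θ := by
  convert! (hasDerivAt_circlePoint θ).inv (circlePoint_ne_zero θ) using 1
  field_simp [circlePoint_ne_zero θ]

lemma circlePoint_neg_pi : circlePoint (-Real.pi) = circlePoint Real.pi := by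
  rw [circlePoint_neg, circlePoint, mul_comm, Complex.exp_pi_mul_I]; norm_num

/-- The weight `e^{s (z + 1/z)}` on the unit circle. -/
noncomputable def circleWeight (s : ℂ) (θ : ℝ) : ℂ :=
  Complex.exp (s * (circlePoint θ + (circlePoint θ)⁻¹))

@[fun_prop] lemma continuous_circleWeight (s : ℂ) : Continuous (circleWeight s) := by
  unfold circleWeight; fun_prop

lemma circleWeight_neg (s : ℂ) (θ : ℝ) : circleWeight s (-θ) = circleWeight s θ := by
  simp [circleWeight, circlePoint_neg, add_comm]

@[fun_prop] lemma continuous_eval_circlePoint (p : ℂ[X]) :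
    Continuous fun θ => p.eval (circlePoint θ) := p.continuous.comp continuous_circlePoint

@[fun_prop] lemma continuous_eval_circlePoint_inv (p : ℂ[X]) :
    Continuous fun θ => p.eval (circlePoint θ)⁻¹ := p.continuous.comp continuous_circlePoint_inv

/-- The pairing `(p, q) ↦ (1/2π) ∫ p(z) q(1/z) e^{s (z + 1/z)} dθ` of polynomials. -/
noncomputable def circlePairing (s : ℂ) : ℂ[X] →ₗ[ℂ] ℂ[X] →ₗ[ℂ] ℂ :=
  LinearMap.mk₂ ℂ (fun p q => (2 * Real.pi : ℂ)⁻¹ * ∫ θ in -Real.pi..Real.pi,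
      p.eval (circlePoint θ) * q.eval (circlePoint θ)⁻¹ * circleWeight s θ)
    (fun p p' q => by
      rw [← mul_add, ← intervalIntegral.integral_add
        (Continuous.intervalIntegrable (by fun_prop) _ _)
        (Continuous.intervalIntegrable (by fun_prop) _ _)]
      simp only [eval_add, add_mul])
    (fun c p q => by
      simp only [eval_smul, smul_eq_mul, mul_assoc, intervalIntegral.integral_const_mul]
      ring)
    (fun p q q' => by
      rw [← mul_add, ← intervalIntegral.integral_add
        (Continuous.intervalIntegrable (by fun_prop) _ _)
        (Continuous.intervalIntegrable (by fun_prop) _ _)]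
      simp only [eval_add, add_mul, mul_add])
    (fun c p q => by
      simp only [eval_smul, smul_eq_mul, mul_left_comm _ c, mul_assoc,
        intervalIntegral.integral_const_mul])

variable (s : ℂ)

lemma circlePairing_apply (p q : ℂ[X]) :
    circlePairing s p q = (2 * Real.pi : ℂ)⁻¹ * ∫ θ in -Real.pi..Real.pi,
      p.eval (circlePoint θ) * q.eval (circlePoint θ)⁻¹ * circleWeight s θ := rfl

lemma circlePairing_symm (p q : ℂ[X]) : circlePairing s p q = circlePairing s q p := by
  have h := intervalIntegral.integral_comp_neg (a := -Real.pi) (b := Real.pi)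
    fun θ => p.eval (circlePoint θ) * q.eval (circlePoint θ)⁻¹ * circleWeight s θ
  rw [neg_neg] at h
  rw [circlePairing_apply, circlePairing_apply, ← h]
  simp only [circlePoint_neg, circleWeight_neg, inv_inv, mul_comm (eval _ p)]

lemma circlePairing_shift (p q : ℂ[X]) :
    circlePairing s (X * p) (X * q) = circlePairing s p q := by
  rw [circlePairing_apply, circlePairing_apply]
  congr 2 with θ
  simp only [eval_mul, eval_X]
  field_simp [circlePoint_ne_zero θ]

/-- The integrand p(z) q(1/z) e^{s(z+1/z)} is 2π-periodic in θ, so its θ-derivative integrates to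
zero. -/
lemma circlePairing_integration_by_parts (p q : ℂ[X]) :
    circlePairing s (X * derivative p) q - circlePairing s p (X * derivative q) +
      s * (circlePairing s (X * p) q - circlePairing s p (X * q)) = 0 := by
  have hd : ∀ θ : ℝ, HasDerivAt
      (fun θ => p.eval (circlePoint θ) * q.eval (circlePoint θ)⁻¹ * circleWeight s θ)
      (Complex.I * ((((X * derivative p).eval (circlePoint θ) * q.eval (circlePoint θ)⁻¹ *
          circleWeight s θ) -
        p.eval (circlePoint θ) * (X * derivative q).eval (circlePoint θ)⁻¹ * circleWeight s θ) +
        s * (((X * p).eval (circlePoint θ) * q.eval (circlePoint θ)⁻¹ * circleWeight s θ) -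
        p.eval (circlePoint θ) * (X * q).eval (circlePoint θ)⁻¹ * circleWeight s θ))) θ := by
    intro θ
    have hp := (p.hasDerivAt (circlePoint θ)).comp θ (hasDerivAt_circlePoint θ)
    have hq := (q.hasDerivAt (circlePoint θ)⁻¹).comp θ (hasDerivAt_circlePoint_inv θ)
    have hw := (((hasDerivAt_circlePoint θ).add (hasDerivAt_circlePoint_inv θ)).const_mul s).cexp
    convert! (hp.mul hq).mul hw using 1
    simp only [eval_mul, eval_X, circleWeight, Function.comp_apply, Pi.add_apply, Pi.mul_apply]
    ring
  have hint := intervalIntegral.integral_eq_sub_of_hasDerivAt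
    (a := -Real.pi) (b := Real.pi) (fun θ _ => hd θ)
    (Continuous.intervalIntegrable (by fun_prop) _ _)
  have hw : circleWeight s (-Real.pi) = circleWeight s Real.pi := circleWeight_neg s _
  rw [circlePoint_neg_pi, hw, sub_self, intervalIntegral.integral_const_mul,
    intervalIntegral.integral_add (Continuous.intervalIntegrable (by fun_prop) _ _)
      (Continuous.intervalIntegrable (by fun_prop) _ _), intervalIntegral.integral_const_mul,
    intervalIntegral.integral_sub (Continuous.intervalIntegrable (by fun_prop) _ _)
      (Continuous.intervalIntegrable (by fun_prop) _ _),
    intervalIntegral.integral_sub (Continuous.intervalIntegrable (by fun_prop) _ _)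
      (Continuous.intervalIntegrable (by fun_prop) _ _)] at hint
  have hint' := (mul_eq_zero.1 hint).resolve_left Complex.I_ne_zero
  simp only [circlePairing_apply]
  linear_combination (2 * Real.pi : ℂ)⁻¹ * hint'

/-- For real `s` and `p ≠ 0`, pairing `p` with its coefficientwise conjugate is nonzero. -/
lemma circlePairing_conj_ne_zero (s : ℝ) {p : ℂ[X]} (hp : p ≠ 0) :
    circlePairing s p (p.map (starRingEnd ℂ)) ≠ 0 := by
  -- On the circle 1/z is the conjugate of z, so the integrand becomes |p(z)|² e^{2s cos θ},
  -- nonnegative and zero only at roots of p.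
  have hE : ∀ θ : ℝ, p.eval (circlePoint θ) * (p.map (starRingEnd ℂ)).eval (circlePoint θ)⁻¹ *
      circleWeight s θ =
      ((‖p.eval (circlePoint θ)‖ ^ 2 * Real.exp (s * (2 * Real.cos θ)) : ℝ) : ℂ) := by
    intro θ
    have h1 : (p.map (starRingEnd ℂ)).eval (circlePoint θ)⁻¹ =
        (starRingEnd ℂ) (p.eval (circlePoint θ)) := by
      rw [← conj_circlePoint, eval_map, eval₂_hom]
    have h2 : circlePoint θ + (circlePoint θ)⁻¹ = 2 * Complex.cos θ := by
      rw [← circlePoint_neg, circlePoint, circlePoint, Complex.two_cos]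
      push_cast
      rw [mul_comm, mul_neg, ← neg_mul, mul_comm]
      ring_nf
    rw [h1, Complex.mul_conj', circleWeight, h2]
    push_cast
    rfl
  rw [circlePairing_apply]
  simp only [hE, intervalIntegral.integral_ofReal]
  have hfin : {θ : ℝ | θ ∈ Set.Ioo (-Real.pi) Real.pi ∧ p.eval (circlePoint θ) = 0}.Finite := by
    refine Set.Finite.of_finite_image (f := circlePoint)
      ((p.roots.toFinset.finite_toSet).subset ?_) ?_
    · rintro _ ⟨θ, hθ, rfl⟩
      simpa [hp] using hθ.2
    · intro x hx y hy hxy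
      have h1 := congrArg Complex.arg hxy
      rwa [circlePoint, circlePoint, mul_comm Complex.I, mul_comm Complex.I,
        Complex.arg_exp_mul_I, Complex.arg_exp_mul_I, (toIocMod_eq_self _).2 ⟨hx.1.1, by linarith [hx.1.2]⟩,
        (toIocMod_eq_self _).2 ⟨hy.1.1, by linarith [hy.1.2]⟩] at h1
  obtain ⟨θ, hθ, hθ'⟩ := ((Set.Ioo_infinite
    (by linarith [Real.pi_pos] : -Real.pi < Real.pi)).sdiff hfin).nonempty
  have hpos : 0 < ∫ θ in -Real.pi..Real.pi,
      ‖p.eval (circlePoint θ)‖ ^ 2 * Real.exp (s * (2 * Real.cos θ)) := by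
    refine intervalIntegral.integral_pos (by linarith [Real.pi_pos])
      (Continuous.continuousOn (by fun_prop)) (fun _ _ => by positivity)
      ⟨θ, Set.Ioo_subset_Icc_self hθ, ?_⟩
    have : p.eval (circlePoint θ) ≠ 0 := fun h => hθ' ⟨hθ, h⟩
    positivity
  refine mul_ne_zero (by simp) (by exact_mod_cast hpos.ne')

end CirclePairing


/-! ### Moments of the weight as Bessel functions. -/

section CirclePairing

open Polynomial

lemma hasSum_integral_exp_mul {u g : ℝ → ℂ} (hu : Continuous u) (hu1 : ∀ θ, ‖u θ‖ = 1)
    (hg : Continuous g) (c : ℂ) (a b : ℝ) :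
    HasSum (fun k : ℕ => c ^ k / (k.factorial : ℂ) * ∫ θ in a..b, u θ ^ k * g θ)
      (∫ θ in a..b, Complex.exp (c * u θ) * g θ) := by
  simp only [← intervalIntegral.integral_const_mul]
  have hsum : ∀ θ, HasSum (fun k : ℕ => ‖c‖ ^ k / (k.factorial : ℝ) * ‖g θ‖)
      (Real.exp ‖c‖ * ‖g θ‖) := fun θ => by
    rw [Real.exp_eq_exp_ℝ]
    exact (NormedSpace.expSeries_div_hasSum_exp ‖c‖).mul_right _
  refine intervalIntegral.hasSum_integral_of_dominated_convergence
    (fun k θ => ‖c‖ ^ k / (k.factorial : ℝ) * ‖g θ‖)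
    (fun k => Continuous.aestronglyMeasurable (by fun_prop))
    (fun k => Filter.Eventually.of_forall fun θ _ => ?_)
    (Filter.Eventually.of_forall fun θ _ => (hsum θ).summable) ?_
    (Filter.Eventually.of_forall fun θ _ => ?_)
  · simp [hu1]
  · simp only [fun θ => (hsum θ).tsum_eq]
    exact Continuous.intervalIntegrable (by fun_prop) _ _
  · have h := (NormedSpace.expSeries_div_hasSum_exp (c * u θ)).mul_right (g θ)
    rw [← Complex.exp_eq_exp_ℂ] at h
    convert! h using 2 with k
    rw [mul_pow]; ring

lemma integral_circlePoint_pow (j m : ℕ) :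
    ∫ θ in -Real.pi..Real.pi, circlePoint θ ^ j * (circlePoint θ)⁻¹ ^ m =
      if j = m then (2 * Real.pi : ℂ) else 0 := by
  have hE : ∀ θ, circlePoint θ ^ j * (circlePoint θ)⁻¹ ^ m =
      Complex.exp (((j : ℂ) - m) * Complex.I * (θ : ℂ)) := by
    intro θ
    rw [circlePoint, ← Complex.exp_neg, ← Complex.exp_nat_mul, ← Complex.exp_nat_mul,
      ← Complex.exp_add]
    ring_nf
  split_ifs with h
  · subst h
    simp only [hE]
    simp
    ring
  · have hc : ((j : ℂ) - m) * Complex.I ≠ 0 :=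
      mul_ne_zero (sub_ne_zero.2 (by exact_mod_cast h)) Complex.I_ne_zero
    simp only [hE]
    rw [integral_exp_mul_complex hc, ← hE, ← hE, circlePoint_neg_pi, sub_self, zero_div]

lemma integral_inv_circlePoint_pow_mul_exp (s : ℂ) (m : ℕ) :
    ∫ θ in -Real.pi..Real.pi, Complex.exp (s * circlePoint θ) * (circlePoint θ)⁻¹ ^ m =
      2 * Real.pi * (s ^ m / (m.factorial : ℂ)) := by
  have h := hasSum_integral_exp_mul (g := fun θ => (circlePoint θ)⁻¹ ^ m) continuous_circlePoint
    norm_circlePoint (by fun_prop) s (-Real.pi) Real.pi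
  simp only [integral_circlePoint_pow] at h
  rw [h.unique (hasSum_single m fun k hk => by simp [hk]), if_pos rfl, mul_comm]

/-- Expand e^{s/z} in powers s^k/k!; the remaining integral extracts the coefficient s^{k+n}/(k+n)!
of e^{sz}. -/
lemma circlePairing_one_X_pow (s : ℂ) (n : ℕ) :
    circlePairing s 1 (X ^ n) = besselI n (2 * s) := by
  have h := hasSum_integral_exp_mul (g := fun θ => Complex.exp (s * circlePoint θ) *
      (circlePoint θ)⁻¹ ^ n) continuous_circlePoint_inv (by simp [norm_circlePoint])
    (by fun_prop) s (-Real.pi) Real.pi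
  have e1 : ∀ (k : ℕ) (θ : ℝ), (circlePoint θ)⁻¹ ^ k * (Complex.exp (s * circlePoint θ) *
      (circlePoint θ)⁻¹ ^ n) =
      Complex.exp (s * circlePoint θ) * (circlePoint θ)⁻¹ ^ (k + n) := by
    intro k θ; ring
  have e2 : ∀ θ : ℝ, Complex.exp (s * (circlePoint θ)⁻¹) * (Complex.exp (s * circlePoint θ) *
      (circlePoint θ)⁻¹ ^ n) = (1 : ℂ[X]).eval (circlePoint θ) *
      (X ^ n : ℂ[X]).eval (circlePoint θ)⁻¹ * circleWeight s θ := by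
    intro θ
    rw [circleWeight, mul_add, Complex.exp_add, eval_one, eval_pow, eval_X]
    ring
  simp only [e1, e2, integral_inv_circlePoint_pow_mul_exp] at h
  have h' := h.mul_left (2 * Real.pi : ℂ)⁻¹
  have hpi : (Real.pi : ℂ) ≠ 0 := by exact_mod_cast Real.pi_ne_zero
  rw [← circlePairing_apply] at h'
  rw [← h'.tsum_eq, besselI]
  congr 1 with k
  field_simp
  ring

end CirclePairing

/-! ### Averages over U(N) as products of norms. -/

section UnitaryAverage

open Polynomial

lemma ofReal_prod_norm_circlePoint_sub {N : ℕ} (θ : Fin N → ℝ) :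
    ((∏ j : Fin N, ∏ k ∈ Finset.Ioi j, ‖circlePoint (θ k) - circlePoint (θ j)‖ ^ 2 : ℝ) : ℂ) =
      (Matrix.vandermonde fun l => circlePoint (θ l)).det *
        (Matrix.vandermonde fun l => (circlePoint (θ l))⁻¹).det := by
  simp only [Matrix.det_vandermonde, ← Finset.prod_mul_distrib, Complex.ofReal_prod,
    ← conj_circlePoint, ← map_sub, Complex.mul_conj', Complex.ofReal_pow]

/-- The average over `U(N)` in terms of any sequence of monic polynomials. -/
lemma unitaryAverage_eq_sum {N : ℕ} {w : ℂ → ℂ} (hw : Continuous fun θ => w (circlePoint θ))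
    {f : Fin N → ℂ[X]} (hdeg : ∀ i, (f i).natDegree = i) (hf : ∀ i, (f i).Monic) :
    unitaryAverage N w = (N.factorial : ℂ)⁻¹ * ∑ σ : Equiv.Perm (Fin N), ∑ τ : Equiv.Perm (Fin N),
      ((σ.sign : ℤ) : ℂ) * ((τ.sign : ℤ) : ℂ) * ∏ l, ((2 * Real.pi : ℂ)⁻¹ *
        ∫ θ in -Real.pi..Real.pi, (f (σ l)).eval (circlePoint θ) *
          (f (τ l)).eval (circlePoint θ)⁻¹ * w (circlePoint θ)) := by
  -- Monic polynomials of degrees 0, …, N-1 may replace the powers in both Vandermonde determinants;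
  -- their Leibniz expansions make the integrand a sum of products in separate variables.
  have hE : ∀ θ : Fin N → ℝ, (∏ l : Fin N, w (circlePoint (θ l))) * (unitaryDensity N θ : ℂ) =
      ∑ σ : Equiv.Perm (Fin N), ∑ τ : Equiv.Perm (Fin N), (N.factorial : ℂ)⁻¹ *
        (((σ.sign : ℤ) : ℂ) * ((τ.sign : ℤ) : ℂ)) * ∏ l, ((2 * Real.pi : ℂ)⁻¹ *
        ((f (σ l)).eval (circlePoint (θ l)) *
          (f (τ l)).eval (circlePoint (θ l))⁻¹ * w (circlePoint (θ l)))) := by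
    intro θ
    rw [unitaryDensity, Complex.ofReal_mul, ofReal_prod_norm_circlePoint_sub,
      Matrix.det_eval_matrixOfPolynomials_eq_det_vandermonde _ f hdeg hf,
      Matrix.det_eval_matrixOfPolynomials_eq_det_vandermonde _ f hdeg hf,
      ← Matrix.det_transpose, ← Matrix.det_transpose (Matrix.of fun i j => eval _ _),
      Matrix.det_apply', Matrix.det_apply', Finset.sum_mul_sum, Finset.mul_sum, Finset.mul_sum]
    refine Finset.sum_congr rfl fun σ _ => ?_
    rw [Finset.mul_sum, Finset.mul_sum]
    refine Finset.sum_congr rfl fun τ _ => ?_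
    simp only [Finset.prod_mul_distrib, Matrix.transpose_apply, Matrix.of_apply,
      Finset.prod_const, Finset.card_univ, Fintype.card_fin]
    push_cast
    rw [one_div, mul_inv, inv_pow]
    ring
  have hI : ∀ i j : Fin N, MeasureTheory.Integrable (fun θ : ℝ => (2 * Real.pi : ℂ)⁻¹ *
        ((f i).eval (circlePoint θ) * (f j).eval (circlePoint θ)⁻¹ * w (circlePoint θ)))
      (MeasureTheory.volume.restrict (Set.Icc (-Real.pi) Real.pi)) := fun i j =>
    (Continuous.continuousOn (continuous_const.mul
      ((Continuous.mul (by fun_prop) (by fun_prop)).mul hw))).integrableOn_compact isCompact_Icc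
  have hP : ∀ σ τ : Equiv.Perm (Fin N), MeasureTheory.Integrable (fun θ : Fin N → ℝ =>
      (N.factorial : ℂ)⁻¹ * (((σ.sign : ℤ) : ℂ) * ((τ.sign : ℤ) : ℂ)) *
        ∏ l, ((2 * Real.pi : ℂ)⁻¹ * ((f (σ l)).eval (circlePoint (θ l)) *
          (f (τ l)).eval (circlePoint (θ l))⁻¹ * w (circlePoint (θ l)))))
      (MeasureTheory.Measure.pi fun _ : Fin N =>
        MeasureTheory.volume.restrict (Set.Icc (-Real.pi) Real.pi)) := fun σ τ =>
    (MeasureTheory.Integrable.fintype_prod fun l => hI (σ l) (τ l)).const_mul _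
  rw [unitaryAverage, MeasureTheory.volume_pi, MeasureTheory.Measure.restrict_pi_pi]
  simp only [hE]
  rw [MeasureTheory.integral_finsetSum _ fun σ _ =>
    MeasureTheory.integrable_finsetSum _ fun τ _ => hP σ τ, Finset.mul_sum]
  refine Finset.sum_congr rfl fun σ _ => ?_
  rw [MeasureTheory.integral_finsetSum _ fun τ _ => hP σ τ, Finset.mul_sum]
  refine Finset.sum_congr rfl fun τ _ => ?_
  rw [MeasureTheory.integral_const_mul, mul_assoc]
  congr 2
  rw [MeasureTheory.integral_fintype_prod_eq_prod (f := fun l θ => (2 * Real.pi : ℂ)⁻¹ *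
        ((f (σ l)).eval (circlePoint θ) * (f (τ l)).eval (circlePoint θ)⁻¹ * w (circlePoint θ)))]
  refine Finset.prod_congr rfl fun l _ => ?_
  rw [MeasureTheory.integral_const_mul, MeasureTheory.integral_Icc_eq_integral_Ioc,
    intervalIntegral.integral_of_le (by linarith [Real.pi_pos])]

/-- A positive real factor leaves the argument, hence the branch, unchanged. This is why τ at 4t has
weight e^{√t(z+1/z)}. -/
lemma cpow_half_four_mul {t : ℂ} (ht : t ≠ 0) :
    (4 * t) ^ (1 / 2 : ℂ) = 2 * t ^ (1 / 2 : ℂ) := by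
  have h4 : (4 : ℂ) = ((4 : ℝ) : ℂ) := by norm_num
  have hl : Real.log 4 = 2 * Real.log 2 := by
    rw [show (4 : ℝ) = 2 ^ 2 by norm_num, Real.log_pow]; norm_num
  rw [Complex.cpow_def_of_ne_zero (mul_ne_zero (by norm_num) ht), Complex.cpow_def_of_ne_zero ht,
    h4, Complex.log_ofReal_mul (by norm_num) ht, add_mul, Complex.exp_add, hl]
  congr 1
  rw [show ((2 * Real.log 2 : ℝ) : ℂ) * (1 / 2) = ((Real.log 2 : ℝ) : ℂ) by push_cast; ring,
    ← Complex.ofReal_exp, Real.exp_log (by norm_num)]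
  norm_num

/-- The `τ`-function is the product of the norms of the monic orthogonal polynomials. -/
lemma tauIII_eq_prod {t : ℂ} (ht : t ≠ 0) {N : ℕ} {f : Fin N → ℂ[X]}
    (hdeg : ∀ i, (f i).natDegree = i) (hf : ∀ i, (f i).Monic)
    (horth : ∀ i j, i ≠ j → circlePairing (t ^ (1 / 2 : ℂ)) (f i) (f j) = 0) :
    tauIII N (4 * t) 0 = ∏ i, circlePairing (t ^ (1 / 2 : ℂ)) (f i) (f i) := by
  have hw : ∀ θ, circlePoint θ ^ (0 : ℤ) * Complex.exp (1 / 2 * (4 * t) ^ (1 / 2 : ℂ) *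
      (circlePoint θ + (circlePoint θ)⁻¹)) = circleWeight (t ^ (1 / 2 : ℂ)) θ := by
    intro θ
    rw [circleWeight, cpow_half_four_mul ht, zpow_zero, one_mul]
    ring_nf
  rw [tauIII, unitaryAverage_eq_sum (by simp only [hw]; fun_prop) hdeg hf]
  simp only [hw, ← circlePairing_apply]
  have hin : ∀ σ : Equiv.Perm (Fin N), ∑ τ : Equiv.Perm (Fin N),
      ((σ.sign : ℤ) : ℂ) * ((τ.sign : ℤ) : ℂ) *
        ∏ l, circlePairing (t ^ (1 / 2 : ℂ)) (f (σ l)) (f (τ l)) =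
      ∏ i, circlePairing (t ^ (1 / 2 : ℂ)) (f i) (f i) := by
    intro σ
    -- Orthogonality kills every τ ≠ σ; the N! equal diagonal terms then cancel the factor 1/N!.
    rw [Finset.sum_eq_single σ]
    · rw [← Int.cast_mul, Int.units_coe_mul_self, Int.cast_one, one_mul,
        Equiv.prod_comp σ fun i => circlePairing (t ^ (1 / 2 : ℂ)) (f i) (f i)]
    · intro τ _ hτ
      obtain ⟨l, hl⟩ : ∃ l, σ l ≠ τ l := by
        by_contra! h
        exact hτ (Equiv.ext fun l => (h l).symm)
      rw [Finset.prod_eq_zero (Finset.mem_univ l) (horth _ _ hl), mul_zero]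
    · simp
  simp only [hin, Finset.sum_const, Finset.card_univ, Fintype.card_perm, Fintype.card_fin,
    nsmul_eq_mul]
  rw [← mul_assoc, inv_mul_cancel₀ (by exact_mod_cast N.factorial_ne_zero), one_mul]

end UnitaryAverage


/-! ### From discrete Painlevé II to orthogonality, and back for t > 0. -/

section DiscretePainleve

open Polynomial

/-- The coefficients of the Szegő recurrence attached to a solution of discrete Painlevé II. -/
def verblunsky (P : ℕ → ℂ) (n : ℕ) : ℂ := (-1) ^ n * P n

lemma verblunsky_sq (P : ℕ → ℂ) (n : ℕ) : verblunsky P n ^ 2 = P n ^ 2 := by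
  rw [verblunsky, mul_pow, ← pow_mul, mul_comm n 2, pow_mul]; norm_num

variable {t : ℂ} {M : ℕ} {P : ℕ → ℂ}

/-- The norm of the `n`-th orthogonal polynomial attached to `P`. -/
noncomputable def szegoNorm (t : ℂ) (P : ℕ → ℂ) (n : ℕ) : ℂ :=
  circlePairing (t ^ (1 / 2 : ℂ)) (szegoPoly (verblunsky P) n) (X ^ n)

lemma szegoNorm_zero : szegoNorm t P 0 = besselI 0 (2 * t ^ (1 / 2 : ℂ)) := by
  rw [szegoNorm, szegoPoly_zero, circlePairing_one_X_pow]

lemma IsDiscretePII.szego_step (ht : t ≠ 0) (h : IsDiscretePII t M P) {n : ℕ} (hn : n < M)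
    (horth : ∀ m ≤ n,
      SzegoOrthogonal (circlePairing (t ^ (1 / 2 : ℂ))) (verblunsky P) m)
    (hnorm : ∀ m < n, szegoNorm t P (m + 1) = szegoNorm t P m * (1 - P (m + 1) ^ 2)) :
    circlePairing (t ^ (1 / 2 : ℂ)) (X * szegoPoly (verblunsky P) n) 1 +
      verblunsky P (n + 1) * szegoNorm t P n = 0 := by
  cases n with
  | zero =>
    have h1 := circlePairing_one_X_pow (t ^ (1 / 2 : ℂ)) 1
    rw [szegoNorm_zero, szegoPoly_zero, mul_one, circlePairing_symm, ← pow_one X, h1, verblunsky,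
      zero_add, h.init_one]
    linear_combination -div_mul_cancel₀ (besselI 1 (2 * t ^ (1 / 2 : ℂ))) h.denom_init
  | succ n =>
    have hs : t ^ (1 / 2 : ℂ) ≠ 0 := by simp [Complex.cpow_eq_zero_iff, ht]
    have hd : 1 - P (n + 1) ^ 2 ≠ 0 := h.denom_step (n + 1) (by omega) hn
    have hstep := h.step (n + 1) (by omega) hn
    have key := SzegoOrthogonal.integration_by_parts (circlePairing_symm _)
      (circlePairing_shift _) (circlePairing_integration_by_parts (t ^ (1 / 2 : ℂ)))
      (by simp [verblunsky, h.init_zero]) (horth n (by omega)) (horth (n + 1) le_rfl)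
    change _ * (_ - _ * szegoNorm t P (n + 1)) = _ * szegoNorm t P n at key
    have hN := hnorm n (by omega)
    rw [add_tsub_cancel_right, eq_div_iff (mul_ne_zero hs hd)] at hstep
    refine (mul_eq_zero.1 (?_ : t ^ (1 / 2 : ℂ) * _ = 0)).resolve_left hs
    rw [hN] at key ⊢
    simp only [verblunsky, pow_succ] at key ⊢
    push_cast at hstep
    -- Once h_{n+1} = h_n (1 - P_{n+1}²) is inserted, what remains is (-1)^n h_n times the Painlevé
    -- equation cleared of its denominator.
    linear_combination key + (-1) ^ n * szegoNorm t P n * hstep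

lemma IsDiscretePII.orthogonal (ht : t ≠ 0) (h : IsDiscretePII t M P) {n : ℕ} (hn : n ≤ M) :
    (∀ m ≤ n, SzegoOrthogonal (circlePairing (t ^ (1 / 2 : ℂ))) (verblunsky P) m) ∧
      ∀ m < n, szegoNorm t P (m + 1) = szegoNorm t P m * (1 - P (m + 1) ^ 2) := by
  induction n with
  | zero => exact ⟨fun m hm => by rw [Nat.le_zero.1 hm]; exact szegoOrthogonal_zero, by simp⟩
  | succ n ih =>
    obtain ⟨h1, h2⟩ := ih (by omega)
    obtain ⟨h3, h4⟩ := (h1 n le_rfl).succ (circlePairing_symm _) (circlePairing_shift _)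
      (h.szego_step ht (by omega) h1 h2)
    rw [verblunsky_sq] at h4
    refine ⟨fun m hm => ?_, fun m hm => ?_⟩
    · rcases hm.eq_or_lt with rfl | hm
      exacts [h3, h1 m (by omega)]
    · rcases (Nat.lt_succ_iff.1 hm).eq_or_lt with rfl | hm
      exacts [h4, h2 m hm]

/-- For M ≥ 1 the index n = M is left out: 1 - P_M² may vanish, and h_M enters only the numerator of
the final ratio. -/
lemma IsDiscretePII.szegoNorm_ne_zero (ht : t ≠ 0) (h : IsDiscretePII t M P) {n : ℕ}
    (hn : n < M ∨ n = 0) : szegoNorm t P n ≠ 0 := by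
  induction n with
  | zero => rw [szegoNorm_zero]; exact h.denom_init
  | succ n ih =>
    rw [(h.orthogonal ht (n := n + 1) (by omega)).2 n (by omega)]
    exact mul_ne_zero (ih (by omega)) (h.denom_step _ (by omega) (by omega))

lemma IsDiscretePII.tauIII_eq (ht : t ≠ 0) (h : IsDiscretePII t M P) {N : ℕ} (hN : N ≤ M + 1) :
    tauIII N (4 * t) 0 = ∏ i ∈ Finset.range N, szegoNorm t P i := by
  have horth := (h.orthogonal ht le_rfl).1
  have hlt : ∀ i j : ℕ, i ≤ M → j < i → circlePairing (t ^ (1 / 2 : ℂ))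
      (szegoPoly (verblunsky P) i) (szegoPoly (verblunsky P) j) = 0 := by
    intro i j hi hj
    rw [(horth i hi).poly_pairing fun m hm => (szego_coeff_of_lt _ j).1 m (by omega),
      (szego_coeff_of_lt _ j).1 i hj, zero_mul]
  rw [tauIII_eq_prod ht (f := fun i : Fin N => szegoPoly (verblunsky P) i)
    (fun i => szegoPoly_natDegree _ _) (fun i => szegoPoly_monic _ _), Finset.prod_range]
  · refine Finset.prod_congr rfl fun i _ => ?_
    rw [(horth i (by omega)).poly_pairing (szego_coeff_of_lt _ _).1, szegoPoly_coeff_self, one_mul,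
      szegoNorm]
  · intro i j hij
    rcases lt_or_gt_of_ne (Fin.val_ne_of_ne hij) with h' | h'
    · rw [circlePairing_symm, hlt j i (by omega) h']
    · rw [hlt i j (by omega) h']

/-- The conjugate of Φ_n is again monic of degree n, so pairing it with Φ_n gives exactly h_n, and
positivity applies without knowing that P is real. -/
lemma IsDiscretePII.szegoNorm_ne_zero_of_pos {t : ℝ} (ht : 0 < t) (h : IsDiscretePII t M P)
    {n : ℕ} (hn : n ≤ M) : szegoNorm t P n ≠ 0 := by
  have hs : (t : ℂ) ^ (1 / 2 : ℂ) = ((t ^ (1 / 2 : ℝ) : ℝ) : ℂ) := by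
    rw [Complex.ofReal_cpow ht.le]; norm_num
  have hp := (h.orthogonal (by exact_mod_cast ht.ne') hn).1 n le_rfl
  have hne := circlePairing_conj_ne_zero (t ^ (1 / 2 : ℝ))
    (szegoPoly_monic (verblunsky P) n).ne_zero
  rwa [← hs, hp.poly_pairing fun m hm => by
    rw [coeff_map, (szego_coeff_of_lt _ n).1 m hm, map_zero], coeff_map, szegoPoly_coeff_self,
    map_one, one_mul] at hne

lemma besselI_zero_ne_zero {t : ℝ} (ht : 0 < t) : besselI 0 (2 * (t : ℂ) ^ (1 / 2 : ℂ)) ≠ 0 := by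
  have hs : (t : ℂ) ^ (1 / 2 : ℂ) = ((t ^ (1 / 2 : ℝ) : ℝ) : ℂ) := by
    rw [Complex.ofReal_cpow ht.le]; norm_num
  have h := circlePairing_conj_ne_zero (t ^ (1 / 2 : ℝ)) (one_ne_zero (α := ℂ[X]))
  rw [Polynomial.map_one, ← hs] at h
  rwa [← circlePairing_one_X_pow, pow_zero]

/-- The solution of discrete Painlevé II, continued through divisions by zero. -/
noncomputable def discretePIISolution (t : ℂ) : ℕ → ℂ
  | 0 => 1
  | 1 => besselI 1 (2 * t ^ (1 / 2 : ℂ)) / besselI 0 (2 * t ^ (1 / 2 : ℂ))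
  | n + 2 => ((n + 1 : ℕ) : ℂ) * discretePIISolution t (n + 1) /
      (t ^ (1 / 2 : ℂ) * (1 - discretePIISolution t (n + 1) ^ 2)) - discretePIISolution t n

lemma discretePIISolution_step (t : ℂ) {n : ℕ} (hn : 1 ≤ n) :
    discretePIISolution t (n + 1) + discretePIISolution t (n - 1) =
      (n : ℂ) * discretePIISolution t n /
        (t ^ (1 / 2 : ℂ) * (1 - discretePIISolution t n ^ 2)) := by
  obtain ⟨n, rfl⟩ : ∃ k, n = k + 1 := ⟨n - 1, by omega⟩
  rw [discretePIISolution, add_tsub_cancel_right, sub_add_cancel]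

lemma isDiscretePII_discretePIISolution {t : ℝ} (ht : 0 < t) (M : ℕ) :
    IsDiscretePII (t : ℂ) M (discretePIISolution t) := by
  induction M with
  | zero =>
    exact ⟨by rw [discretePIISolution], besselI_zero_ne_zero ht, by rw [discretePIISolution],
      fun n _ h => absurd h (by omega), fun n _ h => absurd h (by omega)⟩
  | succ M ih =>
    refine ⟨ih.init_zero, ih.denom_init, ih.init_one, fun n hn hn' => ?_,
      fun n hn _ => discretePIISolution_step _ hn⟩
    obtain ⟨n, rfl⟩ : ∃ k, n = k + 1 := ⟨n - 1, by omega⟩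
    -- The norm at index n + 1 ≤ M is already controlled by the solution up to M, and 1 - P_{n+1}²
    -- is one of its factors.
    have h := ih.szegoNorm_ne_zero_of_pos ht (n := n + 1) (by omega)
    rw [(ih.orthogonal (by exact_mod_cast ht.ne') le_rfl).2 n (by omega)] at h
    exact right_ne_zero_of_mul h

lemma eq_discretePIISolution {t : ℂ} {P : ℕ → ℂ} (h : ∀ M, IsDiscretePII t M P) :
    P = discretePIISolution t := by
  have key : ∀ n, P n = discretePIISolution t n ∧
      P (n + 1) = discretePIISolution t (n + 1) := by
    intro n
    induction n with
    | zero =>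
      exact ⟨by rw [(h 0).init_zero, discretePIISolution],
        by rw [zero_add, (h 0).init_one, discretePIISolution]⟩
    | succ n ih =>
      refine ⟨ih.2, ?_⟩
      have h1 := (h (n + 2)).step (n + 1) (by omega) (by omega)
      have h2 := discretePIISolution_step t (n := n + 1) (by omega)
      rw [add_tsub_cancel_right] at h1 h2
      rw [eq_sub_of_add_eq h1, eq_sub_of_add_eq h2, ih.1, ih.2]
  exact funext fun n => (key n).1

end DiscretePainleve

theorem mainTheorem5 :
    (∀ t : ℝ, 0 < t → ∃! P : ℕ → ℂ, ∀ M : ℕ, IsDiscretePII (t : ℂ) M P) ∧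
    (∀ t : ℂ, t ≠ 0 → ∀ (M : ℕ) (P : ℕ → ℂ), IsDiscretePII t M P →
      ∀ N : ℕ, 1 ≤ N → N ≤ M →
        tauIII N (4 * t) 0 ≠ 0 ∧
        tauIII (N + 1) (4 * t) 0 * tauIII (N - 1) (4 * t) 0 / tauIII N (4 * t) 0 ^ 2
          = 1 - P N ^ 2) := by
  refine ⟨fun t ht => ⟨discretePIISolution t, isDiscretePII_discretePIISolution ht,
    fun P hP => eq_discretePIISolution hP⟩, fun t ht M P h N hN hNM => ?_⟩
  obtain ⟨n, rfl⟩ : ∃ k, N = k + 1 := ⟨N - 1, by omega⟩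
  have hprod : ∏ i ∈ Finset.range n, szegoNorm t P i ≠ 0 :=
    Finset.prod_ne_zero_iff.2 fun i hi =>
      h.szegoNorm_ne_zero ht (Or.inl (by have := Finset.mem_range.1 hi; omega))
  have hlast : szegoNorm t P n ≠ 0 := h.szegoNorm_ne_zero ht (Or.inl (by omega))
  rw [add_tsub_cancel_right, h.tauIII_eq ht (N := n + 1) (by omega),
    h.tauIII_eq ht (N := n + 1 + 1) (by omega), h.tauIII_eq ht (N := n) (by omega),
    Finset.prod_range_succ _ (n + 1), Finset.prod_range_succ _ n, (h.orthogonal ht le_rfl).2 n (by omega)]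
  refine ⟨mul_ne_zero hprod hlast, ?_⟩
  field_simp
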